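/- Let $A\in[0,1]^{m\times n}$ with rows $A_1,\dots,A_m$, let $a\in\mathbb R^m$, $\sigma\in(0,1)$, $\alpha\in\mathbb R$ and $\hat x\in[0,\infty)^n$. The randomized algorithm RELAXATION draws independent $x_i\sim\mathrm{Bernoulli}(\alpha\hat x_i)$ for $i=1,\dots,n$; then, while some constraint $A_k\cdot x\ge a_k$ is violated, it takes the minimal $k$ with $A_k\cdot x<a_k$ and redraws every $x_i$ that currently equals $0$, independently of the others and of the past, as $x_i\sim\mathrm{Bernoulli}(\sigma A_{ki}\alpha\hat x_i)$ (variables equal to $1$ are kept). When no constraint is violated it returns $x\in\{0,1\}^n$. **Theorem.** Suppose that $\hat x_i<1/\alpha$ for all $i$, that $A_k\cdot\hat x\ge a_k$ for all $k=1,\dots,m$, and that $\alpha>\frac{-\ln(1-\sigma)}{\sigma}$ (so $\alpha>1$). Then RELAXATION terminates with probability $1$, and for every $i\in\{1,\dots,n\}$ the vector $x$ that it returns satisfies $$P(x_i=1)\le\alpha\hat x_i\Bigl(1+\sigma\sum_{k=1}^m\frac{A_{ki}}{e^{\sigma\alpha A_k\cdot\hat x}(1-\sigma)^{a_k}-1}\Bigr),$$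 where a term with zero denominator, which is possible only if $a_k=A_k\cdot\hat x=0$, is read as $0$. -/

import Mathlib

open scoped ENNReal

noncomputable section

namespace CoveringIP

/-- The law of a Bernoulli variable: `true` (the value 1) has probability `p`. -/
def bern (p : unitInterval) : PMF Bool :=
  PMF.ofFintype (fun b => if b = true then ENNReal.ofReal p else ENNReal.ofReal (1 - p)) (by
    have h0 : (0 : ℝ) ≤ p := p.2.1
    have h1 : (0 : ℝ) ≤ 1 - p := sub_nonneg.2 p.2.2
    simp [← ENNReal.ofReal_add h0 h1])

/-- A real number read as a probability. Numbers outside `[0, 1]` are clamped; this never happens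
for the parameters of the algorithm below when `0 ≤ xhat i < 1 / α`, `A k i ∈ [0, 1]` and
`σ ∈ [0, 1]`. -/
def toProb (r : ℝ) : unitInterval := Set.projIcc 0 1 zero_le_one r

/-- The joint law of independent `Bool`-valued variables with marginal laws `q i`. -/
def indep {n : ℕ} (q : Fin n → PMF Bool) : PMF (Fin n → Bool) :=
  PMF.ofFintype (fun v => ∏ i, q i (v i)) (by
    have h : ∀ i, ∑ b, q i b = 1 := fun i => by
      simpa [tsum_fintype] using (q i).tsum_coe
    rw [← Fintype.piFinset_univ, ← Finset.prod_univ_sum]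
    simp only [h, Finset.prod_const_one])

variable {m n : ℕ}

/-- A `Bool` vector read as a real 0/1 vector. -/
def toReal (x : Fin n → Bool) : Fin n → ℝ := fun i => if x i = true then 1 else 0

/-- The set of constraints `k` violated by `x`, i.e. with `A_k · x < a_k`. -/
def violated (A : Matrix (Fin m) (Fin n) ℝ) (a : Fin m → ℝ) (x : Fin n → Bool) :
    Finset (Fin m) :=
  {k | dotProduct (A k) (toReal x) < a k}

/-- The initial draw: the `x i` are independent, `x i ∼ Bernoulli (α * xhat i)`. -/
def initial (xhat : Fin n → ℝ) (α : ℝ) : PMF (Fin n → Bool) :=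
  indep fun i => bern (toProb (α * xhat i))

/-- Resampling constraint `k` from the current vector `x`: every variable equal to 0 is redrawn
independently as `Bernoulli (σ * A k i * α * xhat i)`; a variable equal to 1 is kept. -/
def resample (xhat : Fin n → ℝ) (A : Matrix (Fin m) (Fin n) ℝ) (σ α : ℝ) (k : Fin m)
    (x : Fin n → Bool) : PMF (Fin n → Bool) :=
  indep fun i =>
    if x i = false then bern (toProb (σ * A k i * α * xhat i)) else PMF.pure true

/-- One pass through the while loop: if some constraint is violated, resample the one of minimal
index; otherwise the loop has been left and `x` does not change any more. -/
def step (xhat : Fin n → ℝ) (A : Matrix (Fin m) (Fin n) ℝ) (a : Fin m → ℝ) (σ α : ℝ)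
    (x : Fin n → Bool) : PMF (Fin n → Bool) :=
  if h : (violated A a x).Nonempty then resample xhat A σ α ((violated A a x).min' h) x
  else PMF.pure x

/-- The law of the current vector after (at most) `t` passes through the while loop started
at `x`. -/
def run (xhat : Fin n → ℝ) (A : Matrix (Fin m) (Fin n) ℝ) (a : Fin m → ℝ) (σ α : ℝ) :
    ℕ → (Fin n → Bool) → PMF (Fin n → Bool)
  | 0, x => PMF.pure x
  | t + 1, x => (step xhat A a σ α x).bind (run xhat A a σ α t)

/-- The probability that the algorithm RELAXATION terminates with a returned vector in `S`.
It is the limit (a supremum, as a vector that violates no constraint is not changed any more) over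
`t` of the probabilities that the algorithm has terminated within `t` resamplings and its vector
lies in `S`. -/
def relaxationProb (xhat : Fin n → ℝ) (A : Matrix (Fin m) (Fin n) ℝ) (a : Fin m → ℝ) (σ α : ℝ)
    (S : Set (Fin n → Bool)) : ℝ≥0∞ :=
  ⨆ t : ℕ, ((initial xhat α).bind (run xhat A a σ α t)).toOuterMeasure
    {x | violated A a x = ∅ ∧ x ∈ S}

end CoveringIP

end

/-! For each constraint `k`, an expected resampling count bounded by `B k` suffices. One resampling
of `k` turns a zero `x i` into a one with probability `σ * A k i * α * xhat i`, so adding up these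
gains gives the bound on P(x_i = 1) (`expect_run_apply_le`). Each pass before termination resamples
exactly one constraint, so the probability of surviving `t` passes is at most `(∑ k, B k) / t`,
which tends to 0 (`mul_expect_run_violated_le`).

The counts are controlled by `potential`, a product over coordinates with a level `j`. It is 1 at
level 0; resampling any constraint does not increase its expectation
(`expect_resample_potential_le`); and resampling `k` while it is violated pays for lowering the
level by one (`expect_resample_self_potential_le`). Hence the sum of the potentials over the levels
`j ≥ 1` dominates the count. Under the initial law the potential has mean `s ^ j`, with `s` at most
the inverse of the exponential expression in the bound, and the geometric series gives `B k`. -/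

namespace CoveringIP

/-! ### Expectations on finite types. -/

section Expectation

variable {Ω Ω' : Type*} [Fintype Ω] [Fintype Ω']

/-- The expectation of a real function on a finite type. -/
noncomputable def expect (μ : PMF Ω) (f : Ω → ℝ) : ℝ := ∑ y, (μ y).toReal * f y

lemma expect_pure [DecidableEq Ω] (x : Ω) (f : Ω → ℝ) : expect (PMF.pure x) f = f x := by
  unfold expect
  rw [Finset.sum_eq_single x]
  · simp
  · intro y _ hy
    simp [PMF.pure_apply, hy]
  · simp

lemma expect_bind (μ : PMF Ω) (κ : Ω → PMF Ω') (f : Ω' → ℝ) :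
    expect (μ.bind κ) f = expect μ fun x => expect (κ x) f := by
  have h : ∀ y, ((μ.bind κ) y).toReal = ∑ x, (μ x).toReal * (κ x y).toReal := by
    intro y
    rw [PMF.bind_apply, tsum_fintype, ENNReal.toReal_sum]
    · simp
    · exact fun x _ => ENNReal.mul_ne_top (μ.apply_ne_top x) ((κ x).apply_ne_top y)
  simp only [expect, h, Finset.sum_mul, Finset.mul_sum]
  rw [Finset.sum_comm]
  simp only [mul_assoc]

lemma expect_mono (μ : PMF Ω) {f g : Ω → ℝ} (h : ∀ x, f x ≤ g x) : expect μ f ≤ expect μ g :=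
  Finset.sum_le_sum fun x _ => mul_le_mul_of_nonneg_left (h x) ENNReal.toReal_nonneg

lemma expect_add (μ : PMF Ω) (f g : Ω → ℝ) :
    expect μ (fun x => f x + g x) = expect μ f + expect μ g := by
  simp [expect, mul_add, Finset.sum_add_distrib]

lemma expect_const_mul (μ : PMF Ω) (c : ℝ) (f : Ω → ℝ) :
    expect μ (fun x => c * f x) = c * expect μ f := by
  simp [expect, Finset.mul_sum, mul_left_comm]

lemma expect_sum {ι : Type*} (μ : PMF Ω) (s : Finset ι) (f : ι → Ω → ℝ) :
    expect μ (fun x => ∑ j ∈ s, f j x) = ∑ j ∈ s, expect μ (f j) := by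
  simp only [expect, Finset.mul_sum]
  exact Finset.sum_comm

lemma expect_const (μ : PMF Ω) (c : ℝ) : expect μ (fun _ => c) = c := by
  have h : ∑ y, (μ y).toReal = 1 := by
    rw [← ENNReal.toReal_sum fun y _ => μ.apply_ne_top y, ← tsum_fintype (L := .unconditional _),
      μ.tsum_coe]
    simp
  simp [expect, ← Finset.sum_mul, h]

open Classical in
lemma toOuterMeasure_eq_ofReal_expect (μ : PMF Ω) (S : Set Ω) :
    μ.toOuterMeasure S = ENNReal.ofReal (expect μ fun x => if x ∈ S then 1 else 0) := by
  rw [PMF.toOuterMeasure_apply, tsum_fintype, expect,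
    ENNReal.ofReal_sum_of_nonneg fun x _ => by positivity]
  refine Finset.sum_congr rfl fun x _ => ?_
  by_cases hx : x ∈ S <;> simp [hx, ENNReal.ofReal_toReal (μ.apply_ne_top x)]

end Expectation

/-! ### Bernoulli variables and their independent products. -/

lemma coe_toProb {r : ℝ} (h0 : 0 ≤ r) (h1 : r ≤ 1) : (toProb r : ℝ) = r := by
  rw [toProb, Set.projIcc_of_mem zero_le_one ⟨h0, h1⟩]

lemma expect_bern {r : ℝ} (h0 : 0 ≤ r) (h1 : r ≤ 1) (f : Bool → ℝ) :
    expect (bern (toProb r)) f = r * f true + (1 - r) * f false := by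
  have h : 0 ≤ 1 - r := sub_nonneg.2 h1
  simp [expect, bern, coe_toProb h0 h1, ENNReal.toReal_ofReal h0, ENNReal.toReal_ofReal h]

variable {m n : ℕ}

lemma expect_indep_prod (q : Fin n → PMF Bool) (h : Fin n → Bool → ℝ) :
    expect (indep q) (fun v => ∏ i, h i (v i)) = ∏ i, expect (q i) (h i) := by
  simp only [expect, indep, PMF.ofFintype_apply, ENNReal.toReal_prod, ← Finset.prod_mul_distrib]
  rw [Finset.prod_univ_sum, Fintype.piFinset_univ]

lemma expect_indep_apply (q : Fin n → PMF Bool) (i : Fin n) (g : Bool → ℝ) :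
    expect (indep q) (fun v => g (v i)) = expect (q i) g := by
  have h := expect_indep_prod q fun j => if j = i then g else fun _ => 1
  have hl : ∀ v : Fin n → Bool,
      ∏ j, (if j = i then g else fun _ => 1) (v j) = g (v i) := by
    intro v
    rw [Finset.prod_eq_single i] <;> simp +contextual
  simp only [hl] at h
  rw [h, Finset.prod_eq_single i]
  · simp
  · intro j _ hj
    simp [hj, expect_const]
  · simp

/-! ### The potential and its behaviour under resampling. -/

/-- One factor of `potential`. -/
noncomputable def factor (c d p : ℝ) (j : ℕ) (b : Bool) : ℝ :=
  if b = true then c ^ j else c ^ j + (d ^ j - c ^ j) / (1 - p)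

/-- A function of the current vector that bounds the probability that constraint `k` will be
resampled at least `j` times. -/
noncomputable def potential (xhat : Fin n → ℝ) (A : Matrix (Fin m) (Fin n) ℝ) (a : Fin m → ℝ)
    (σ α : ℝ) (k : Fin m) (j : ℕ) (x : Fin n → Bool) : ℝ :=
  ((1 - σ) ^ (-a k)) ^ j *
    ∏ i, factor (1 - σ * A k i) (1 - σ * A k i * α * xhat i) (α * xhat i) j (x i)

lemma factor_nonneg {c d p : ℝ} (hc : 0 ≤ c) (hcd : c ≤ d) (hp : p < 1) (j : ℕ) (b : Bool) :
    0 ≤ factor c d p j b := by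
  have h1 : c ^ j ≤ d ^ j := pow_le_pow_left₀ hc hcd j
  have h2 : 0 ≤ (d ^ j - c ^ j) / (1 - p) := div_nonneg (sub_nonneg.2 h1) (sub_nonneg.2 hp.le)
  unfold factor
  split_ifs <;> positivity

lemma factor_true_le {c d p : ℝ} (hc : 0 ≤ c) (hcd : c ≤ d) (hp : p < 1) (j : ℕ) :
    factor c d p j true ≤ factor c d p j false := by
  have h1 : c ^ j ≤ d ^ j := pow_le_pow_left₀ hc hcd j
  simpa [factor] using div_nonneg (sub_nonneg.2 h1) (sub_nonneg.2 hp.le)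

/-- This identity determines the value of `factor` at `false`, once its value at `true` is `c ^ j`.
-/
lemma factor_initial {c d p : ℝ} (hp : p < 1) (j : ℕ) :
    p * factor c d p j true + (1 - p) * factor c d p j false = d ^ j := by
  have : 1 - p ≠ 0 := (sub_pos.2 hp).ne'
  simp only [factor]
  norm_num
  field_simp
  ring

/-- With `c = 1 - s` and `d = 1 - s * p`, one has `d - c = s * (1 - p)`, which cancels the
denominator. At a coordinate equal to one the counterpart is `c * c ^ j = c ^ (j + 1)`. -/
lemma factor_resample {s p : ℝ} (hp : p < 1) (j : ℕ) :
    s * p * factor (1 - s) (1 - s * p) p j true +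
      (1 - s * p) * factor (1 - s) (1 - s * p) p j false =
      factor (1 - s) (1 - s * p) p (j + 1) false := by
  have : 1 - p ≠ 0 := (sub_pos.2 hp).ne'
  simp only [factor]
  norm_num
  field_simp
  ring

variable {xhat : Fin n → ℝ} {A : Matrix (Fin m) (Fin n) ℝ} {a : Fin m → ℝ} {σ α : ℝ}

/-- The parameters of the algorithm are probabilities, and `α * xhat i` is not 1. -/
structure Admissible (xhat : Fin n → ℝ) (A : Matrix (Fin m) (Fin n) ℝ) (σ α : ℝ) : Prop where
  entry_nonneg : ∀ k i, 0 ≤ A k i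
  entry_le_one : ∀ k i, A k i ≤ 1
  sigma_pos : 0 < σ
  sigma_lt_one : σ < 1
  prob_nonneg : ∀ i, 0 ≤ α * xhat i
  prob_lt_one : ∀ i, α * xhat i < 1

namespace Admissible

lemma mul_nonneg' (H : Admissible xhat A σ α) (k : Fin m) (i : Fin n) : 0 ≤ σ * A k i :=
  mul_nonneg H.sigma_pos.le (H.entry_nonneg k i)

lemma mul_le_one' (H : Admissible xhat A σ α) (k : Fin m) (i : Fin n) : σ * A k i ≤ 1 :=
  mul_le_one₀ H.sigma_lt_one.le (H.entry_nonneg k i) (H.entry_le_one k i)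

lemma rate_nonneg (H : Admissible xhat A σ α) (k : Fin m) (i : Fin n) :
    0 ≤ σ * A k i * α * xhat i := by
  rw [mul_assoc]
  exact mul_nonneg (H.mul_nonneg' k i) (H.prob_nonneg i)

lemma rate_le (H : Admissible xhat A σ α) (k : Fin m) (i : Fin n) :
    σ * A k i * α * xhat i ≤ σ * A k i := by
  rw [mul_assoc]
  exact mul_le_of_le_one_right (H.mul_nonneg' k i) (H.prob_lt_one i).le

lemma rate_le_one (H : Admissible xhat A σ α) (k : Fin m) (i : Fin n) :
    σ * A k i * α * xhat i ≤ 1 := (H.rate_le k i).trans (H.mul_le_one' k i)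

lemma factor_nonneg (H : Admissible xhat A σ α) (k : Fin m) (i : Fin n) (j : ℕ) (b : Bool) :
    0 ≤ factor (1 - σ * A k i) (1 - σ * A k i * α * xhat i) (α * xhat i) j b :=
  CoveringIP.factor_nonneg (sub_nonneg.2 (H.mul_le_one' k i))
    (sub_le_sub_left (H.rate_le k i) 1) (H.prob_lt_one i) j b

lemma weight_nonneg (H : Admissible xhat A σ α) (k : Fin m) : 0 ≤ (1 - σ) ^ (-a k) :=
  Real.rpow_nonneg (sub_nonneg.2 H.sigma_lt_one.le) _

lemma potential_nonneg (H : Admissible xhat A σ α) (k : Fin m) (j : ℕ) (x : Fin n → Bool) :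
    0 ≤ potential xhat A a σ α k j x :=
  mul_nonneg (pow_nonneg (H.weight_nonneg k) j)
    (Finset.prod_nonneg fun i _ => H.factor_nonneg k i j (x i))

end Admissible

lemma potential_zero (k : Fin m) (x : Fin n → Bool) : potential xhat A a σ α k 0 x = 1 := by
  simp [potential, factor]

lemma expect_initial_potential (H : Admissible xhat A σ α) (k : Fin m) (j : ℕ) :
    expect (initial xhat α) (potential xhat A a σ α k j) =
      ((1 - σ) ^ (-a k) * ∏ i, (1 - σ * A k i * α * xhat i)) ^ j := by
  unfold potential initial
  rw [expect_const_mul, expect_indep_prod, mul_pow, ← Finset.prod_pow]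
  congr 1
  refine Finset.prod_congr rfl fun i _ => ?_
  rw [expect_bern (H.prob_nonneg i) (H.prob_lt_one i).le, factor_initial (H.prob_lt_one i)]

/-- Resampling only turns zeros into ones, and each factor is no larger at `true` than at `false`.
-/
lemma expect_resample_potential_le (H : Admissible xhat A σ α) (l k : Fin m) (j : ℕ)
    (x : Fin n → Bool) :
    expect (resample xhat A σ α l x) (potential xhat A a σ α k j) ≤
      potential xhat A a σ α k j x := by
  unfold potential resample
  rw [expect_const_mul, expect_indep_prod]
  refine mul_le_mul_of_nonneg_left (Finset.prod_le_prod (fun i _ => ?_) fun i _ => ?_)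
    (pow_nonneg (H.weight_nonneg k) j)
  · exact Finset.sum_nonneg fun b _ => mul_nonneg ENNReal.toReal_nonneg (H.factor_nonneg k i j b)
  · cases hx : x i
    · rw [if_pos rfl, expect_bern (H.rate_nonneg l i) (H.rate_le_one l i)]
      have h := factor_true_le (sub_nonneg.2 (H.mul_le_one' k i))
        (sub_le_sub_left (H.rate_le k i) 1) (H.prob_lt_one i) j
      nlinarith [mul_le_mul_of_nonneg_left h (H.rate_nonneg l i)]
    · rw [if_neg (by simp), expect_pure]

/-- The ones of a vector violating constraint `k` are avoided by a random set of indices, chosen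
with probabilities `σ * A k i`, with probability at least `(1 - σ) ^ a k`. -/
lemma one_le_weight_mul_prod (H : Admissible xhat A σ α) {k : Fin m} {x : Fin n → Bool}
    (hk : k ∈ violated A a x) :
    1 ≤ (1 - σ) ^ (-a k) * ∏ i, (if x i = true then 1 - σ * A k i else 1) := by
  have hσ : 0 < 1 - σ := sub_pos.2 H.sigma_lt_one
  have hk' : dotProduct (A k) (toReal x) < a k := by simpa [violated] using hk
  have h1 : (1 - σ) ^ a k ≤ ∏ i, (if x i = true then 1 - σ * A k i else 1) := by
    calc (1 - σ) ^ a k ≤ (1 - σ) ^ dotProduct (A k) (toReal x) :=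
          Real.rpow_le_rpow_of_exponent_ge hσ (by linarith [H.sigma_pos]) hk'.le
      _ = ∏ i, (1 - σ) ^ (A k i * toReal x i) := Real.rpow_sum_of_pos hσ _ _
      _ ≤ _ := by
        refine Finset.prod_le_prod (fun i _ => Real.rpow_nonneg hσ.le _) fun i _ => ?_
        by_cases hx : x i = true
        -- Bernoulli's inequality for exponents in `[0, 1]`: `(1 - σ) ^ A k i ≤ 1 - σ * A k i`.
        · have h := rpow_one_add_le_one_add_mul_self (s := -σ) (by linarith [H.sigma_lt_one])
            (H.entry_nonneg k i) (H.entry_le_one k i)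
          simp only [toReal, hx, if_true, mul_one]
          calc (1 - σ) ^ A k i = (1 + -σ) ^ A k i := by rw [sub_eq_add_neg]
            _ ≤ 1 + A k i * -σ := h
            _ = _ := by ring
        · simp [toReal, hx]
  calc 1 = (1 - σ) ^ (-a k) * (1 - σ) ^ a k := by rw [← Real.rpow_add hσ]; simp
    _ ≤ _ := mul_le_mul_of_nonneg_left h1 (H.weight_nonneg k)

lemma expect_resample_self_potential_le (H : Admissible xhat A σ α) {k : Fin m} (j : ℕ)
    {x : Fin n → Bool} (hk : k ∈ violated A a x) :
    expect (resample xhat A σ α k x) (potential xhat A a σ α k j) ≤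
      potential xhat A a σ α k (j + 1) x := by
  have hw := one_le_weight_mul_prod H hk
  have h0 : 0 ≤ expect (resample xhat A σ α k x) (potential xhat A a σ α k j) :=
    Finset.sum_nonneg fun y _ => mul_nonneg ENNReal.toReal_nonneg (H.potential_nonneg k j y)
  -- The multiplier supplies what level `j + 1` has in excess of level `j`: one more weight `(1 - σ)
  -- ^ (-a k)` and one more `1 - σ * A k i` for every coordinate equal to one. The zeros gain their
  -- level through the redraw, and equality holds coordinatewise.
  refine (le_mul_of_one_le_left h0 hw).trans_eq ?_
  unfold potential resample
  rw [expect_const_mul, expect_indep_prod, mul_mul_mul_comm, ← pow_succ', ← Finset.prod_mul_distrib]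
  congr 1
  refine Finset.prod_congr rfl fun i _ => ?_
  cases hx : x i
  · rw [if_pos rfl, expect_bern (H.rate_nonneg k i) (H.rate_le_one k i)]
    have h := factor_resample (s := σ * A k i) (H.prob_lt_one i) j
    simp only [← mul_assoc] at h
    simpa using h
  · rw [if_pos rfl, if_neg (by simp), expect_pure]
    simp [factor, pow_succ']

/-! ### Expected numbers of resamplings and what they control. -/

/-- The expected number of times that constraint `k` is resampled in the first `t` passes through
the loop started at `x`. -/
noncomputable def resampleCount (xhat : Fin n → ℝ) (A : Matrix (Fin m) (Fin n) ℝ) (a : Fin m → ℝ)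
    (σ α : ℝ) (k : Fin m) : ℕ → (Fin n → Bool) → ℝ
  | 0, _ => 0
  | t + 1, x =>
    (if ∃ h : (violated A a x).Nonempty, (violated A a x).min' h = k then 1 else 0) +
      expect (step xhat A a σ α x) (resampleCount xhat A a σ α k t)

lemma resampleCount_nonneg (k : Fin m) (t : ℕ) (x : Fin n → Bool) :
    0 ≤ resampleCount xhat A a σ α k t x := by
  induction t generalizing x with
  | zero => exact le_rfl
  | succ t ih =>
    refine add_nonneg (by split_ifs <;> norm_num) ?_
    exact Finset.sum_nonneg fun y _ => mul_nonneg ENNReal.toReal_nonneg (ih y)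

lemma step_of_violated_eq_empty {x : Fin n → Bool} (hx : violated A a x = ∅) :
    step xhat A a σ α x = PMF.pure x := by
  simp [step, hx]

/-- A resampling of `k` shifts every level down by one, and the freed lowest level pays for the
resampling itself; any other pass leaves all levels nonincreasing in expectation. -/
lemma resampleCount_le_sum_potential (H : Admissible xhat A σ α) (k : Fin m) (t : ℕ)
    (x : Fin n → Bool) :
    resampleCount xhat A a σ α k t x ≤
      ∑ j ∈ Finset.range t, potential xhat A a σ α k (j + 1) x := by
  induction t generalizing x with
  | zero => simp [resampleCount]
  | succ t ih =>
    rw [resampleCount]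
    have h := expect_mono (step xhat A a σ α x) ih
    rw [expect_sum] at h
    by_cases hx : (violated A a x).Nonempty
    · simp only [step, dif_pos hx] at h ⊢
      by_cases hk : (violated A a x).min' hx = k
      · have hmem : k ∈ violated A a x := hk ▸ Finset.min'_mem _ hx
        rw [if_pos ⟨hx, hk⟩, Finset.sum_range_succ', add_comm]
        rw [hk] at h ⊢
        refine add_le_add (h.trans (Finset.sum_le_sum fun j _ =>
          expect_resample_self_potential_le H (j + 1) hmem)) ?_
        -- Level 0 is identically 1, so at a vector violating `k` the level 1 potential is at least
        -- 1, which covers the indicator.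
        have h1 := expect_resample_self_potential_le H 0 hmem
        rwa [funext (potential_zero k), expect_const] at h1
      · rw [if_neg fun hc => hk hc.2, zero_add, Finset.sum_range_succ]
        exact (h.trans (Finset.sum_le_sum fun j _ =>
          expect_resample_potential_le H _ k (j + 1) x)).trans
            (le_add_of_nonneg_right (H.potential_nonneg k _ x))
    · rw [if_neg fun hc => hx hc.1, zero_add, Finset.sum_range_succ]
      rw [step_of_violated_eq_empty (Finset.not_nonempty_iff_eq_empty.1 hx)] at h ⊢
      simp only [expect_pure] at h ⊢
      exact h.trans (le_add_of_nonneg_right (H.potential_nonneg k _ x))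

/-- Such a constraint is never violated, as `A k` and 0/1 vectors are nonnegative. This covers the
void constraints, where the geometric series may have ratio 1. -/
lemma resampleCount_eq_zero (hA : ∀ k i, 0 ≤ A k i) {k : Fin m} (hk : a k ≤ 0) (t : ℕ)
    (x : Fin n → Bool) : resampleCount xhat A a σ α k t x = 0 := by
  induction t generalizing x with
  | zero => rfl
  | succ t ih =>
    rw [resampleCount, funext ih, expect_const, add_zero, if_neg]
    rintro ⟨h, hmin⟩
    have hmem : k ∈ violated A a x := hmin ▸ Finset.min'_mem _ h
    have hlt : dotProduct (A k) (toReal x) < a k := by simpa [violated] using hmem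
    have h0 : 0 ≤ dotProduct (A k) (toReal x) :=
      Finset.sum_nonneg fun i _ => mul_nonneg (hA k i) (by unfold toReal; split_ifs <;> norm_num)
    linarith

lemma run_of_violated_eq_empty {x : Fin n → Bool} (hx : violated A a x = ∅) (t : ℕ) :
    run xhat A a σ α t x = PMF.pure x := by
  induction t with
  | zero => rfl
  | succ t ih => rw [run, step_of_violated_eq_empty hx, PMF.pure_bind, ih]

/-- A vector that is still violating after `t` passes has undergone `t` resamplings, so this is
Markov's inequality for their total number. -/
lemma mul_expect_run_violated_le (t : ℕ) (x : Fin n → Bool) :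
    t * expect (run xhat A a σ α t x) (fun y => if violated A a y = ∅ then 0 else 1) ≤
      ∑ k, resampleCount xhat A a σ α k t x := by
  induction t generalizing x with
  | zero => simp [resampleCount]
  | succ t ih =>
    by_cases hx : violated A a x = ∅
    · rw [run_of_violated_eq_empty hx, expect_pure, if_pos hx, mul_zero]
      exact Finset.sum_nonneg fun k _ => resampleCount_nonneg k _ x
    · have hne := Finset.nonempty_iff_ne_empty.2 hx
      have h1 : ∑ k, (if ∃ h : (violated A a x).Nonempty, (violated A a x).min' h = k
          then (1 : ℝ) else 0) = 1 := by
        rw [Finset.sum_eq_single ((violated A a x).min' hne)]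
        · rw [if_pos ⟨hne, rfl⟩]
        · exact fun k _ hk => if_neg fun hc => hk hc.2.symm
        · simp
      have h2 := expect_mono (step xhat A a σ α x) ih
      rw [expect_const_mul, expect_sum, ← expect_bind] at h2
      -- Passing from the factor `t` to `t + 1` costs at most 1, which the resampling of the current
      -- pass pays.
      have h3 : expect (run xhat A a σ α (t + 1) x)
          (fun y => if violated A a y = ∅ then 0 else 1) ≤ 1 := by
        refine (expect_mono _ fun y => ?_).trans_eq (expect_const _ 1)
        split_ifs <;> norm_num
      simp only [resampleCount, Finset.sum_add_distrib, h1]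
      rw [run] at h3 ⊢
      push_cast
      linarith

lemma expect_run_apply_le (H : Admissible xhat A σ α) (i : Fin n) (t : ℕ) (x : Fin n → Bool) :
    expect (run xhat A a σ α t x) (fun y => if y i = true then 1 else 0) ≤
      (if x i = true then 1 else 0) +
        ∑ k, σ * A k i * α * xhat i * resampleCount xhat A a σ α k t x := by
  induction t generalizing x with
  | zero => simp [run, expect_pure, resampleCount]
  | succ t ih =>
    have h := expect_mono (step xhat A a σ α x) ih
    rw [← expect_bind, expect_add, expect_sum] at h
    simp only [expect_const_mul] at h
    rw [run]
    refine h.trans ?_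
    simp only [resampleCount, mul_add, Finset.sum_add_distrib]
    rw [← add_assoc]
    refine add_le_add_left ?_ _
    by_cases hx : (violated A a x).Nonempty
    · have h1 : ∑ k, σ * A k i * α * xhat i *
          (if ∃ h : (violated A a x).Nonempty, (violated A a x).min' h = k
            then (1 : ℝ) else 0) =
          σ * A ((violated A a x).min' hx) i * α * xhat i := by
        rw [Finset.sum_eq_single ((violated A a x).min' hx)]
        · rw [if_pos ⟨hx, rfl⟩, mul_one]
        · intro k _ hk
          rw [if_neg fun hc => hk hc.2.symm, mul_zero]
        · simp
      rw [h1, step, dif_pos hx, resample,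
        expect_indep_apply _ i fun b => if b = true then (1 : ℝ) else 0]
      cases hxi : x i
      · rw [if_pos rfl, expect_bern (H.rate_nonneg _ i) (H.rate_le_one _ i)]
        simp
      · rw [if_neg (by simp), expect_pure]
        -- A coordinate already equal to one gains nothing, yet the bound charges it the rate; this
        -- is the only loss in a pass that resamples.
        simpa using H.rate_nonneg _ i
    · rw [step_of_violated_eq_empty (Finset.not_nonempty_iff_eq_empty.1 hx), expect_pure]
      refine le_add_of_nonneg_right (Finset.sum_nonneg fun k _ => ?_)
      exact mul_nonneg (H.rate_nonneg k i) (by split_ifs <;> norm_num)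

/-! ### The geometric series and its ratio. -/

lemma expect_initial_resampleCount_le (H : Admissible xhat A σ α) (k : Fin m)
    (hD : 1 < Real.exp (σ * α * dotProduct (A k) xhat) * (1 - σ) ^ a k) (t : ℕ) :
    expect (initial xhat α) (resampleCount xhat A a σ α k t) ≤
      1 / (Real.exp (σ * α * dotProduct (A k) xhat) * (1 - σ) ^ a k - 1) := by
  set D := Real.exp (σ * α * dotProduct (A k) xhat) * (1 - σ) ^ a k with hDdef
  have hσ : 0 < 1 - σ := sub_pos.2 H.sigma_lt_one
  have hprod0 : 0 ≤ ∏ i, (1 - σ * A k i * α * xhat i) :=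
    Finset.prod_nonneg fun i _ => sub_nonneg.2 (H.rate_le_one k i)
  have hprod : ∏ i, (1 - σ * A k i * α * xhat i) ≤
      Real.exp (-(σ * α * dotProduct (A k) xhat)) := by
    rw [dotProduct, Finset.mul_sum, ← Finset.sum_neg_distrib, Real.exp_sum]
    refine Finset.prod_le_prod (fun i _ => sub_nonneg.2 (H.rate_le_one k i)) fun i _ => ?_
    refine (Real.one_sub_le_exp_neg _).trans_eq ?_
    congr 1
    ring
  set s := (1 - σ) ^ (-a k) * ∏ i, (1 - σ * A k i * α * xhat i) with hs
  have hs0 : 0 ≤ s := mul_nonneg (H.weight_nonneg k) hprod0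
  have hsD : s ≤ D⁻¹ := by
    refine (mul_le_mul_of_nonneg_left hprod (H.weight_nonneg k)).trans_eq ?_
    rw [hDdef, mul_inv, Real.exp_neg, Real.rpow_neg hσ.le, mul_comm]
  have hD0 : 0 < D := zero_lt_one.trans hD
  have hDi : D⁻¹ < 1 := inv_lt_one_of_one_lt₀ hD
  have h := expect_mono (initial xhat α) (resampleCount_le_sum_potential (a := a) H k t)
  rw [expect_sum] at h
  simp only [expect_initial_potential H, ← hs] at h
  refine h.trans ?_
  calc ∑ j ∈ Finset.range t, s ^ (j + 1)
      ≤ ∑ j ∈ Finset.range t, D⁻¹ ^ (j + 1) :=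
        Finset.sum_le_sum fun j _ => pow_le_pow_left₀ hs0 hsD _
    _ = D⁻¹ * ∑ j ∈ Finset.range t, D⁻¹ ^ j := by simp only [pow_succ', Finset.mul_sum]
    _ ≤ D⁻¹ * (1 - D⁻¹)⁻¹ := by
        refine mul_le_mul_of_nonneg_left ?_ (inv_nonneg.2 hD0.le)
        rw [← tsum_geometric_of_lt_one (inv_nonneg.2 hD0.le) hDi]
        exact (summable_geometric_of_lt_one (inv_nonneg.2 hD0.le) hDi).sum_le_tsum _
          fun j _ => pow_nonneg (inv_nonneg.2 hD0.le) j
    _ = 1 / (D - 1) := by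
        have : D - 1 ≠ 0 := (sub_pos.2 hD).ne'
        rw [← mul_inv, mul_sub, mul_one, mul_inv_cancel₀ hD0.ne', one_div]

/-- The denominators in the bound are positive when the constraint is not void. -/
lemma one_lt_exp_mul_rpow {c b σ α : ℝ} (hσ0 : 0 < σ) (hσ1 : σ < 1)
    (hα : -Real.log (1 - σ) / σ < α) (hc : 0 < c) (hb : b ≤ c) :
    1 < Real.exp (σ * α * c) * (1 - σ) ^ b := by
  have hσ : 0 < 1 - σ := sub_pos.2 hσ1
  rw [Real.rpow_def_of_pos hσ, ← Real.exp_add, Real.one_lt_exp_iff]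
  have hlog : Real.log (1 - σ) < 0 := Real.log_neg hσ (by linarith)
  have h1 : -Real.log (1 - σ) < α * σ := (div_lt_iff₀ hσ0).1 hα
  -- The exponent splits as `(σ * α + log (1 - σ)) * c + log (1 - σ) * (b - c)`, a positive term
  -- plus a nonnegative one.
  nlinarith [mul_pos (sub_pos.2 h1) hc, mul_nonneg_of_nonpos_of_nonpos hlog.le (sub_nonpos.2 hb)]

end CoveringIP

/-- RELAXATION terminates almost surely (so that its conclusion makes sense), and for every variable
`i` the probability that `x i = 1` at its conclusion obeys the stated bound. -/
theorem theorem2p5 {m n : ℕ} (A : Matrix (Fin m) (Fin n) ℝ) (a : Fin m → ℝ) (xhat : Fin n → ℝ)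
    (σ α : ℝ)
    (hA : ∀ k i, A k i ∈ Set.Icc (0 : ℝ) 1)
    (hσ : 0 < σ ∧ σ < 1)
    (hxhat : ∀ i, 0 ≤ xhat i ∧ xhat i < 1 / α)
    (hcover : ∀ k, a k ≤ dotProduct (A k) xhat)
    (hα : -Real.log (1 - σ) / σ < α) :
    CoveringIP.relaxationProb xhat A a σ α Set.univ = 1 ∧
    ∀ i : Fin n,
      CoveringIP.relaxationProb xhat A a σ α {x | x i = true} ≤
        ENNReal.ofReal (α * xhat i * (1 + σ * ∑ k : Fin m,
          A k i / (Real.exp (σ * α * dotProduct (A k) xhat) * (1 - σ) ^ (a k) - 1))) := by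
  classical
  obtain ⟨hσ0, hσ1⟩ := hσ
  have hα0 : 0 < α :=
    (div_pos (neg_pos.2 (Real.log_neg (sub_pos.2 hσ1) (by linarith))) hσ0).trans hα
  have H : CoveringIP.Admissible xhat A σ α :=
    { entry_nonneg := fun k i => (hA k i).1
      entry_le_one := fun k i => (hA k i).2
      sigma_pos := hσ0
      sigma_lt_one := hσ1
      prob_nonneg := fun i => mul_nonneg hα0.le (hxhat i).1
      prob_lt_one := fun i => by
        rw [mul_comm]
        exact (lt_div_iff₀ hα0).1 (hxhat i).2 }
  set B : Fin m → ℝ := fun k =>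
    1 / (Real.exp (σ * α * dotProduct (A k) xhat) * (1 - σ) ^ (a k) - 1) with hB
  have hcount : ∀ k t, CoveringIP.expect (CoveringIP.initial xhat α)
      (CoveringIP.resampleCount xhat A a σ α k t) ≤ B k := by
    intro k t
    have h0 : 0 ≤ dotProduct (A k) xhat :=
      Finset.sum_nonneg fun i _ => mul_nonneg (hA k i).1 (hxhat i).1
    rcases h0.eq_or_lt with h0 | h0
    -- If `A k` and `xhat` are orthogonal, the count is 0 and only `0 ≤ B k` is needed. For `a k =
    -- 0` the denominator vanishes and `B k` is 0 by the convention for division by zero.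
    · have ha : a k ≤ 0 := h0 ▸ hcover k
      rw [funext (CoveringIP.resampleCount_eq_zero H.entry_nonneg ha t), CoveringIP.expect_const]
      have := Real.one_le_rpow_of_pos_of_le_one_of_nonpos (sub_pos.2 hσ1) (by linarith) ha
      simp only [hB, ← h0, mul_zero, Real.exp_zero, one_mul]
      exact div_nonneg zero_le_one (sub_nonneg.2 this)
    · exact CoveringIP.expect_initial_resampleCount_le H k
        (CoveringIP.one_lt_exp_mul_rpow hσ0 hσ1 hα h0 (hcover k)) t
  unfold CoveringIP.relaxationProb
  simp only [CoveringIP.toOuterMeasure_eq_ofReal_expect]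
  constructor
  · refine le_antisymm (iSup_le fun t => ?_) ?_
    · rw [← ENNReal.ofReal_one]
      refine ENNReal.ofReal_le_ofReal ((CoveringIP.expect_mono _ fun y => ?_).trans_eq
        (CoveringIP.expect_const _ 1))
      split_ifs <;> norm_num
    · have hbound : ∀ t : ℕ, 0 < t → 1 - (∑ k, B k) / t ≤ CoveringIP.expect
          ((CoveringIP.initial xhat α).bind (CoveringIP.run xhat A a σ α t))
          (fun y => if y ∈ {x | CoveringIP.violated A a x = ∅ ∧ x ∈ Set.univ} then 1 else 0) := by
        intro t ht
        have h1 := CoveringIP.expect_mono (CoveringIP.initial xhat α)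
          (CoveringIP.mul_expect_run_violated_le (xhat := xhat) (A := A) (a := a) (σ := σ)
            (α := α) t)
        rw [CoveringIP.expect_const_mul, ← CoveringIP.expect_bind, CoveringIP.expect_sum] at h1
        have h2 := h1.trans (Finset.sum_le_sum fun k _ => hcount k t)
        rw [mul_comm, ← le_div_iff₀ (Nat.cast_pos.2 ht)] at h2
        have h3 := CoveringIP.expect_add
          ((CoveringIP.initial xhat α).bind (CoveringIP.run xhat A a σ α t))
          (fun y => if y ∈ {x | CoveringIP.violated A a x = ∅ ∧ x ∈ Set.univ} then 1 else 0)
          (fun y => if CoveringIP.violated A a y = ∅ then 0 else 1)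
        have h4 : (fun y => (if y ∈ {x | CoveringIP.violated A a x = ∅ ∧ x ∈ Set.univ}
            then (1 : ℝ) else 0) + if CoveringIP.violated A a y = ∅ then 0 else 1) =
            fun _ => 1 := by
          funext y
          by_cases hy : CoveringIP.violated A a y = ∅ <;> simp [hy]
        rw [h4, CoveringIP.expect_const] at h3
        linarith
      have hlim : Filter.Tendsto (fun t : ℕ => ENNReal.ofReal (1 - (∑ k, B k) / t)) Filter.atTop
          (nhds 1) := by
        have h := (tendsto_const_div_atTop_nhds_zero_nat (∑ k, B k)).const_sub 1
        rw [sub_zero] at h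
        simpa using ENNReal.tendsto_ofReal h
      refine le_of_tendsto hlim ?_
      filter_upwards [Filter.eventually_gt_atTop 0] with t ht
      refine le_iSup_of_le t (ENNReal.ofReal_le_ofReal ?_)
      convert hbound t ht using 4
      rfl
  · intro i
    -- The bound holds uniformly in `t`, even when the requirement of having terminated is dropped.
    refine iSup_le fun t => ENNReal.ofReal_le_ofReal ?_
    have h1 := CoveringIP.expect_mono (CoveringIP.initial xhat α)
      (CoveringIP.expect_run_apply_le (a := a) H i t)
    rw [← CoveringIP.expect_bind, CoveringIP.expect_add, CoveringIP.expect_sum,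
      CoveringIP.initial, CoveringIP.expect_indep_apply _ i fun b => if b = true then (1 : ℝ) else 0,
      CoveringIP.expect_bern (H.prob_nonneg i) (H.prob_lt_one i).le, ← CoveringIP.initial] at h1
    simp only [CoveringIP.expect_const_mul] at h1
    calc _ ≤ CoveringIP.expect
          ((CoveringIP.initial xhat α).bind (CoveringIP.run xhat A a σ α t))
          (fun y => if y i = true then 1 else 0) := by
          refine CoveringIP.expect_mono _ fun y => ?_
          by_cases hy : y i = true <;> simp [hy]
          split_ifs <;> norm_num
      _ ≤ _ := h1
      _ ≤ α * xhat i + ∑ k, σ * A k i * α * xhat i * B k := by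
          refine add_le_add (by simp) (Finset.sum_le_sum fun k _ => ?_)
          exact mul_le_mul_of_nonneg_left (hcount k t) (H.rate_nonneg k i)
      _ = _ := by
          rw [mul_add, mul_one, Finset.mul_sum, Finset.mul_sum]
          congr 1
          refine Finset.sum_congr rfl fun k _ => ?_
          simp only [hB]
          ring
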